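/- \textbf{Setting.} A data set is a finite multiset of points of $\mathbb{R}^d$, $d\ge 1$; two data sets are neighbouring if one arises from the other by adding one point. A randomised algorithm $M$ is $(\varepsilon,\delta)$-DP if $\Pr[M(D_0)\in O]\le e^{\varepsilon}\Pr[M(D_1)\in O]+\delta$ for all neighbouring $D_0,D_1$ (in either order) and all measurable $O$. \textbf{The algorithm.} Fix a range $[a,b]$ with $a<b$, a split interval size $\beta>0$, centreness parameters $0<2q\le t\le 1$, a weight $\alpha>0$, a threshold $\tau_e\in\mathbb{R}$ and a maximum recursion depth $\tau_r\ge 1$. Fix per-level budgets $0<\varepsilon_{\mathrm{cnt},i}\le\varepsilon_{\mathrm{cnt}}$ ($0\le i\le\tau_r$) and $0<\varepsilon_{\mathrm{exp},i}\le\varepsilon_{\mathrm{exp}}$ ($0\le i<\tau_r$); this covers constant budgets and the distribution $\varepsilon\sqrt{2^i}/\sum_j\sqrt{2^j}$. Fix $0<\delta_{\mathrm{cnt}}\le1$ and offsets $\lambda_i\ge 0$ with $\lambda_i\ge-\ln(2\delta_{\mathrm{cnt}})/\varepsilon_{\mathrm{cnt},i}$ ($0\le i<\tau_r$). The split candidates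 are the pairs $s=(i,j)$ of a dimension $i\in\{0,\dots,d-1\}$ and an index $0\le j<\lceil (b-a)/\beta\rceil$, at position $p_s=a+(j+\tfrac12)\beta$. For a data set $S$ and $\tilde n>0$ let $r$ be the number of $x\in S$ with $x^{(i)}<p_s$ and $|s|$ the number of $x\in S$ with $|x^{(i)}-p_s|\le\beta/2$. The emptiness is $e(S,\tilde n,s)=1-|s|/\tilde n$. The centreness $c(S,\tilde n,s)$ is \[\frac{t-2q}{1-2q}+\frac{(\frac{\tilde n}2-|r-\frac{\tilde n}2|)(1-t)}{\frac{\tilde n}2-\tilde nq}\ \text{ if } r\in(\tilde nq,\tilde n-\tilde nq),\qquad \frac{(\frac{\tilde n}2-|r-\frac{\tilde n}2|)\,t}{\tilde nq}\ \text{ otherwise.}\] The score is $f=c+\alpha e$. \emph{Noisy count} on level $\gamma$: $\tilde n_S=|S|+\mathrm{Lap}(1/\varepsilon_{\mathrm{cnt},\gamma})$. \emph{Split selection} on level $\gamma$ for $(S,\tilde n)$: if $\tilde n>\lambda_\gamma$, draw $s$ with probability proportional to $\exp\big(\varepsilon_{\mathrm{exp},\gamma}f(S,\tilde n,s)/(2\Delta_f)\big)$,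 where $\Delta_f=\frac{t/q+\alpha}{\tilde n-\lambda_\gamma}$; if $\tilde n\le\lambda_\gamma$, draw $s$ uniformly ($\Delta_f=\infty$). The split $s=(i,j)$ divides $S$ into $S_1=\{x\in S: x^{(i)}\le p_s\}$ and $S_2=\{x\in S: x^{(i)}>p_s\}$. \textsc{BuildClustering}$(S,\tilde n,\gamma)$: if $\gamma=\tau_r$, output the cluster $S$ with weight $\tilde n$. Otherwise select a split, and draw noisy counts $\tilde n_{S_1},\tilde n_{S_2}$ on level $\gamma+1$. If one of them is $<\tau_e$, output the cluster $S$ with weight $\tilde n$; else apply the split and call \textsc{BuildClustering}$(S_k,\tilde n_{S_k},\gamma+1)$ for $k=1,2$. All random choices are independent given their inputs. DPM draws $\tilde n_D$ on level $0$ and calls \textsc{BuildClustering}$(D,\tilde n_D,0)$. What is released is the tree of applied splits, whose leaves are the cells of $\mathbb{R}^d$ that define the clusters, together with the weight of each leaf; the data points themselves are not released. \textbf{Claim.} \begin{enumerate} \item (One recursion level.) Let $\gamma<\tau_r$ and let $C_1,\dots,C_m\subseteq\mathbb{R}^d$ be pairwise disjoint. Let $S_j$ be the part of $D$ in $C_j$,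 and use independent randomness for different $j$. Then the algorithm that performs, for every $j$, one step of \textsc{BuildClustering}$(S_j,\tilde n_j,\gamma)$ with given numbers $\tilde n_j$, and releases for every $j$ the selected split and the two noisy counts, is $(\varepsilon_{\mathrm{cnt}}+\varepsilon_{\mathrm{exp}},\delta_{\mathrm{cnt}})$-DP. So is the algorithm that releases, for every $j$, the noisy count $\tilde n_{S_j}$ on level $\gamma$ and then a split selected for $(S_j,\tilde n_{S_j})$. \item (All levels.) Producing the clusters and weights of DPM is $((\tau_r+1)\varepsilon_{\mathrm{cnt}}+\tau_r\varepsilon_{\mathrm{exp}},\ (\tau_r+1)\delta_{\mathrm{cnt}})$-DP. \end{enumerate} -/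

import Mathlib

open MeasureTheory ProbabilityTheory

noncomputable section

/-- Data points in `ℝ^d`. -/
abbrev Point (d : ℕ) : Type := Fin d → ℝ

/-- A data set is a finite collection of points, repetitions allowed. -/
abbrev DataSet (d : ℕ) : Type := Multiset (Point d)

/-- Neighbouring data sets: one arises from the other by adding one data point. -/
def Neighbouring {d : ℕ} (D₀ D₁ : DataSet d) : Prop :=
  (∃ x, D₁ = x ::ₘ D₀) ∨ (∃ x, D₀ = x ::ₘ D₁)

/-- A randomised algorithm `M` (its output law on each data set is `M D`, a probability measure)
is `(ε, δ)`-differentially private. -/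
structure IsDP {d : ℕ} {A : Type} [MeasurableSpace A]
    (M : DataSet d → Measure A) (ε δ : ℝ) : Prop where
  isProbabilityMeasure : ∀ D, IsProbabilityMeasure (M D)
  le : ∀ D₀ D₁, Neighbouring D₀ D₁ → ∀ O : Set A, MeasurableSet O →
    M D₀ O ≤ ENNReal.ofReal (Real.exp ε) * M D₁ O + ENNReal.ofReal δ

/-- The centred Laplace distribution with scale `b > 0`. -/
def laplace (b : ℝ) : Measure ℝ :=
  volume.withDensity fun x => ENNReal.ofReal (1 / (2 * b) * Real.exp (-|x| / b))

/-- The exponential mechanism for the score function `f`, privacy parameter `ε` and sensitivity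
`Δ > 0`: the candidate `s` is drawn with probability proportional to `exp (ε f(s) / (2 Δ))`. -/
def expMechanism {W : Type} [Fintype W] [MeasurableSpace W] (f : W → ℝ) (ε Δ : ℝ) : Measure W :=
  ∑ s : W, ENNReal.ofReal
    (Real.exp (ε * f s / (2 * Δ)) / ∑ s' : W, Real.exp (ε * f s' / (2 * Δ))) • Measure.dirac s

/-- The (data independent) input parameters of the algorithm in dimension `d`. -/
structure DPMParams (d : ℕ) where
  /-- maximum recursion depth -/
  τr : ℕ
  /-- minimum number of elements -/
  τe : ℝ
  /-- the range of the data is `[a, b]` -/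
  a : ℝ
  b : ℝ
  /-- split interval size -/
  β : ℝ
  /-- centreness parameters -/
  t : ℝ
  q : ℝ
  /-- weight of the emptiness -/
  α : ℝ
  /-- budget for the noisy counts on recursion level `i` -/
  εcnt : ℕ → ℝ
  /-- budget for the split selection on recursion level `i` -/
  εexp : ℕ → ℝ
  /-- offset on recursion level `i` -/
  lam : ℕ → ℝ

namespace DPMParams

variable {d : ℕ} (P : DPMParams d)

/-- Number of split candidates per dimension. -/
def numSplits : ℕ := ⌈(P.b - P.a) / P.β⌉₊

/-- Split candidates: a dimension and the index of one of its split intervals. -/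
abbrev Candidate : Type := Fin d × Fin P.numSplits

/-- The position of a split candidate: the centre of its interval. -/
def position (c : P.Candidate) : ℝ := P.a + ((c.2 : ℕ) + 1 / 2) * P.β

/-- The number `|s|` of points in the split interval around the candidate. -/
def intervalCount (S : DataSet d) (c : P.Candidate) : ℕ :=
  (S.filter fun x => P.position c - P.β / 2 ≤ x c.1 ∧ x c.1 ≤ P.position c + P.β / 2).card

/-- The index of the candidate when inserted into the sorted list of `c.1`-th coordinates. -/
def rank (S : DataSet d) (c : P.Candidate) : ℕ :=
  (S.filter fun x => x c.1 < P.position c).card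

/-- Emptiness, for the noisy count `n`. -/
def emptiness (S : DataSet d) (n : ℝ) (c : P.Candidate) : ℝ :=
  1 - (P.intervalCount S c : ℝ) / n

/-- Centreness, for the noisy count `n`. The inner formula applies to ranks in the inner quantile
`(n q, n - n q)`, the outer formula to all others (ranks above `n` included). -/
def centreness (S : DataSet d) (n : ℝ) (c : P.Candidate) : ℝ :=
  let r : ℝ := P.rank S c
  if n * P.q < r ∧ r < n - n * P.q then
    (P.t - 2 * P.q) / (1 - 2 * P.q) + (n / 2 - |r - n / 2|) * (1 - P.t) / (n / 2 - n * P.q)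
  else
    (n / 2 - |r - n / 2|) * P.t / (n * P.q)

/-- The scoring function. -/
def score (S : DataSet d) (n : ℝ) (c : P.Candidate) : ℝ :=
  P.centreness S n c + P.α * P.emptiness S n c

/-- Noisy count of `S` on recursion level `γ`: `|S| + Lap(1 / ε_cnt,γ)`. -/
def noisyCount (γ : ℕ) (S : DataSet d) : Measure ℝ :=
  (laplace (1 / P.εcnt γ)).map fun z => (S.card : ℝ) + z

/-- Selection of a split candidate on level `γ`: exponential mechanism with sensitivity
`Δ = (t/q + α) / (n - λ_γ)`. If `n ≤ λ_γ`, there is no finite positive `Δ`, and the choice is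
uniform, as for `Δ = ∞`. -/
def selectSplit (γ : ℕ) (S : DataSet d) (n : ℝ) : Measure P.Candidate :=
  if P.lam γ < n then
    expMechanism (P.score S n) (P.εexp γ) ((P.t / P.q + P.α) / (n - P.lam γ))
  else
    uniformOn Set.univ

/-- The two disjoint subsets produced by a split. -/
def leftPart (S : DataSet d) (c : P.Candidate) : DataSet d :=
  S.filter fun x => x c.1 ≤ P.position c

def rightPart (S : DataSet d) (c : P.Candidate) : DataSet d :=
  S.filter fun x => P.position c < x c.1

/-- What one call of the recursive procedure on `(S, n, γ)` reads off the data before its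
recursive calls: the selected split, and noisy counts of the two parts. -/
def splitAndCount (γ : ℕ) (S : DataSet d) (n : ℝ) : Measure (P.Candidate × ℝ × ℝ) :=
  (P.selectSplit γ S n).bind fun c =>
    ((P.noisyCount (γ + 1) (P.leftPart S c)).prod
      (P.noisyCount (γ + 1) (P.rightPart S c))).map fun m => (c, m)

/-- The noisy count of `S` on level `γ`, followed by the selection of a split of `S`. -/
def countAndSplit (γ : ℕ) (S : DataSet d) : Measure (ℝ × P.Candidate) :=
  (P.noisyCount γ S).bind fun n => (P.selectSplit γ S n).map fun c => (n, c)

/-- Clusterings with weights that use at most `k` nested splits: either one cluster, given by its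
weight (`Sum.inl`), or an applied split with clusterings of its two sides (`Sum.inr`). Each leaf is
a cluster: its cell in `ℝ^d` is cut out by the splits above it. -/
def Clustering : ℕ → Type
  | 0 => ℝ
  | k + 1 => ℝ ⊕ (P.Candidate × Clustering k × Clustering k)

/-- The one-cluster clustering with weight `n`. -/
def Clustering.leaf : (k : ℕ) → ℝ → P.Clustering k
  | 0, n => n
  | _ + 1, n => Sum.inl n

/-- The clustering that applies the split `c` and clusters its two sides by `w`. -/
def Clustering.node {k : ℕ} (c : P.Candidate) (w : P.Clustering k × P.Clustering k) :
    P.Clustering (k + 1) :=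
  (Sum.inr (c, w) : ℝ ⊕ (P.Candidate × P.Clustering k × P.Clustering k))

instance Clustering.instMeasurableSpace : (k : ℕ) → MeasurableSpace (P.Clustering k)
  | 0 => inferInstanceAs (MeasurableSpace ℝ)
  | k + 1 =>
    letI := Clustering.instMeasurableSpace k
    inferInstanceAs (MeasurableSpace (ℝ ⊕ (P.Candidate × P.Clustering k × P.Clustering k)))

/-- The recursive procedure on the subset `S` with noisy count `n` on level `γ`, when `k` further
levels are allowed. It stops when `k = 0`, or when a part of the selected split has a noisy count
below `τe`; otherwise it recurses on both parts, with independent randomness. -/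
def buildClustering : (k γ : ℕ) → DataSet d → ℝ → Measure (P.Clustering k)
  | 0, _, _, n => Measure.dirac (Clustering.leaf P 0 n)
  | k + 1, γ, S, n =>
    (P.splitAndCount γ S n).bind fun o =>
      if o.2.1 < P.τe ∨ o.2.2 < P.τe then
        Measure.dirac (Clustering.leaf P (k + 1) n)
      else
        ((buildClustering k (γ + 1) (P.leftPart S o.1) o.2.1).prod
          (buildClustering k (γ + 1) (P.rightPart S o.1) o.2.2)).map
            (Clustering.node P o.1)

/-- Law of the clusters and weights that the algorithm produces on the data set `D`. -/
def clustersAndWeights (D : DataSet d) : Measure (P.Clustering P.τr) :=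
  (P.noisyCount 0 D).bind fun n => P.buildClustering P.τr 0 D n

open Classical in
/-- The part of the data set that lies in `C`. -/
def restrict (D : DataSet d) (C : Set (Point d)) : DataSet d := D.filter (· ∈ C)

/-- Admissible parameters for the budgets `εcnt`, `εexp` per level and the failure probability `δ`
of the offsets. -/
structure Valid (εcnt εexp δ : ℝ) : Prop where
  dim_pos : 0 < d
  τr_pos : 0 < P.τr
  range : P.a < P.b
  β_pos : 0 < P.β
  q_pos : 0 < 2 * P.q
  q_le_t : 2 * P.q ≤ P.t
  t_le_one : P.t ≤ 1
  α_pos : 0 < P.α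
  δ_pos : 0 < δ
  δ_le_one : δ ≤ 1
  εcnt_pos : ∀ i ≤ P.τr, 0 < P.εcnt i
  εcnt_le : ∀ i ≤ P.τr, P.εcnt i ≤ εcnt
  εexp_pos : ∀ i < P.τr, 0 < P.εexp i
  εexp_le : ∀ i < P.τr, P.εexp i ≤ εexp
  lam_nonneg : ∀ i < P.τr, 0 ≤ P.lam i
  lam_ge : ∀ i < P.τr, -Real.log (2 * δ) / P.εcnt i ≤ P.lam i

end DPMParams

end

/-! The privacy is pure: on neighbouring data sets every law involved is dominated by `exp ε` times
the other as a measure, and the additive term is mere slack. The reason is that, for a given noisy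
count `n`, the score has sensitivity at most `(t/q + α)/n`. For `n > λ_γ ≥ 0` this is below the
`(t/q + α)/(n - λ_γ)` used by the exponential mechanism, and for `n ≤ λ_γ` the choice ignores the
data (`selectSplit_le_smul`).

Domination multiplies along `bind` and products (`bind_le_smul_bind`, `prod_le_smul_prod`,
`pi_le_smul_pi`). The added point lies in at most one of several disjoint cells, so a whole level
costs `εcnt + εexp` once. Descending the tree, only one side of each split changes
(`neighbouring_parts`), so `k` levels cost `k (εcnt + εexp)` (`buildClustering_le_smul`); the count
at the root adds one `εcnt`. -/

open scoped ENNReal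

/-! ### Domination of measures up to a constant factor. -/

namespace MeasureTheory.Measure

variable {A B : Type} [MeasurableSpace A] [MeasurableSpace B]

theorem bind_le_smul_bind {μ ν : Measure A} {κ η : A → Measure B} {c c' : ℝ≥0∞}
    (hκ : Measurable κ) (hη : Measurable η) (h : μ ≤ c • ν) (h' : ∀ a, κ a ≤ c' • η a) :
    μ.bind κ ≤ (c * c') • ν.bind η := by
  refine Measure.le_iff.2 fun s hs => ?_
  rw [bind_apply hs hκ.aemeasurable, smul_apply, bind_apply hs hη.aemeasurable]
  calc ∫⁻ a, κ a s ∂μ ≤ ∫⁻ a, c' * η a s ∂(c • ν) := lintegral_mono' h fun a => h' a s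
    _ = (c * c') • ∫⁻ a, η a s ∂ν := by
      rw [lintegral_smul_measure, lintegral_const_mul _ (measurable_measure.1 hη s hs)]
      simp [mul_assoc]

theorem le_smul_self_of_one_le {c : ℝ≥0∞} (hc : 1 ≤ c) (μ : Measure A) : μ ≤ c • μ :=
  Measure.le_iff.2 fun _ _ => le_mul_of_one_le_left' hc

theorem smul_mono_of_le {c c' : ℝ≥0∞} (hc : c ≤ c') (μ : Measure A) : c • μ ≤ c' • μ :=
  Measure.le_iff.2 fun s _ => mul_le_mul_left hc (μ s)

theorem map_le_smul_map {μ ν : Measure A} {f : A → B} {c : ℝ≥0∞} (hf : Measurable f)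
    (h : μ ≤ c • ν) : μ.map f ≤ c • ν.map f := by
  rw [← Measure.map_smul]
  exact Measure.map_mono h hf

theorem prod_le_smul_prod {μ μ' : Measure A} {ν ν' : Measure B} [SFinite ν] [SFinite ν']
    {c c' : ℝ≥0∞} (h : μ ≤ c • μ') (h' : ν ≤ c' • ν') :
    μ.prod ν ≤ (c * c') • μ'.prod ν' := by
  refine Measure.le_iff.2 fun s hs => ?_
  rw [prod_apply hs, smul_apply, prod_apply hs]
  calc ∫⁻ a, ν (Prod.mk a ⁻¹' s) ∂μ ≤ ∫⁻ a, c' * ν' (Prod.mk a ⁻¹' s) ∂(c • μ') :=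
        lintegral_mono' h fun a => h' _
    _ = (c * c') • ∫⁻ a, ν' (Prod.mk a ⁻¹' s) ∂μ' := by
      rw [lintegral_smul_measure, lintegral_const_mul _ (measurable_measure_prodMk_left hs)]
      simp [mul_assoc]

/-- `Measure.pi` comes from the largest outer measure below the product of the measures of the
projections, so comparing these products suffices. Finite constants can be moved through
`OuterMeasure.boundedBy`. -/
theorem pi_le_smul_pi {ι : Type} [Fintype ι] {μ ν : ι → Measure A} {c : ι → ℝ≥0∞}
    (hc : ∀ i, c i ≠ ∞) (h : ∀ i, μ i ≤ c i • ν i) :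
    Measure.pi μ ≤ (∏ i, c i) • Measure.pi ν := by
  have key : OuterMeasure.pi (fun i => (μ i).toOuterMeasure) ≤
      (∏ i, c i) • OuterMeasure.pi (fun i => (ν i).toOuterMeasure) := by
    unfold OuterMeasure.pi
    rw [OuterMeasure.smul_boundedBy (ENNReal.prod_ne_top fun i _ => hc i),
      OuterMeasure.le_boundedBy]
    intro s
    refine (OuterMeasure.boundedBy_le s).trans ?_
    simp only [piPremeasure, Pi.smul_apply, smul_eq_mul, ← Finset.prod_mul_distrib]
    exact Finset.prod_le_prod' fun i _ => h i _
  refine Measure.le_iff.2 fun s hs => ?_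
  rw [smul_apply, Measure.pi_def, Measure.pi_def, toMeasure_apply _ _ hs, toMeasure_apply _ _ hs]
  exact key s

end MeasureTheory.Measure

open MeasureTheory.Measure

/-! ### Measurable dependence of products and binds on a parameter. -/

theorem Measurable.measure_prod_of_isProbabilityMeasure {X A B : Type} [MeasurableSpace X]
    [MeasurableSpace A] [MeasurableSpace B] {f : X → Measure A} {g : X → Measure B}
    (hf : Measurable f) (hg : Measurable g) [hf' : ∀ x, IsProbabilityMeasure (f x)]
    [hg' : ∀ x, IsProbabilityMeasure (g x)] : Measurable fun x => (f x).prod (g x) := by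
  let κ : Kernel X A := ⟨f, hf⟩
  let η : Kernel X B := ⟨g, hg⟩
  have : IsMarkovKernel κ := ⟨hf'⟩
  have : IsMarkovKernel η := ⟨hg'⟩
  have h : (fun x => (f x).prod (g x)) = κ ×ₖ η := by
    ext1 x
    rw [Kernel.prod_apply]
    rfl
  rw [h]
  exact (κ ×ₖ η).measurable

theorem Measurable.bind_of_measurable_prod {X A B : Type} [MeasurableSpace X] [MeasurableSpace A]
    [MeasurableSpace B] {κ : X → Measure A} {η : X × A → Measure B} (hκ : Measurable κ)
    [hκ' : ∀ x, IsProbabilityMeasure (κ x)] (hη : Measurable η) :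
    Measurable fun x => (κ x).bind fun a => η (x, a) := by
  let κ' : Kernel X A := ⟨κ, hκ⟩
  have : IsMarkovKernel κ' := ⟨hκ'⟩
  refine Measure.measurable_of_measurable_coe _ fun s hs => ?_
  have h : ∀ x, (κ x).bind (fun a => η (x, a)) s = ∫⁻ a, η (x, a) s ∂κ' x := fun x =>
    bind_apply hs (hη.comp measurable_prodMk_left).aemeasurable
  simp only [h]
  exact Measurable.lintegral_kernel_prod_right' ((Measure.measurable_coe hs).comp hη)

theorem isProbabilityMeasure_bind_of_measurable {A B : Type} [MeasurableSpace A]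
    [MeasurableSpace B] {μ : Measure A} {κ : A → Measure B} [IsProbabilityMeasure μ]
    (hκ : Measurable κ) (h : ∀ a, IsProbabilityMeasure (κ a)) :
    IsProbabilityMeasure (μ.bind κ) :=
  ⟨by rw [bind_apply MeasurableSet.univ hκ.aemeasurable]; simp⟩

/-! ### Neighbouring data sets -/

section Neighbouring

variable {d : ℕ} {D D' : DataSet d}

/-- The point is chosen before the predicate, so that all cells of a partition are compared through
the same added point. -/
theorem Neighbouring.exists_filter (h : Neighbouring D D') :
    ∃ x, ∀ (p : Point d → Prop) [DecidablePred p],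
      (p x → Neighbouring (D.filter p) (D'.filter p)) ∧ (¬ p x → D.filter p = D'.filter p) := by
  rcases h with ⟨x, rfl⟩ | ⟨x, rfl⟩ <;> refine ⟨x, fun p _ => ⟨fun hp => ?_, fun hp => ?_⟩⟩
  · exact Or.inl ⟨x, Multiset.filter_cons_of_pos _ hp⟩
  · exact (Multiset.filter_cons_of_neg _ hp).symm
  · exact Or.inr ⟨x, Multiset.filter_cons_of_pos _ hp⟩
  · exact Multiset.filter_cons_of_neg _ hp

theorem Neighbouring.abs_card_sub_card (h : Neighbouring D D') :
    |(D.card : ℝ) - D'.card| = 1 := by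
  rcases h with ⟨x, rfl⟩ | ⟨x, rfl⟩ <;> simp

theorem Neighbouring.abs_card_filter_sub_card_filter (h : Neighbouring D D')
    (p : Point d → Prop) [DecidablePred p] :
    |((D.filter p).card : ℝ) - (D'.filter p).card| ≤ 1 := by
  obtain ⟨x, hx⟩ := h.exists_filter
  by_cases hp : p x
  · exact ((hx p).1 hp).abs_card_sub_card.le
  · simp [(hx p).2 hp]

end Neighbouring

/-- Domination is the form of privacy that composes; adding `ENNReal.ofReal δ` only weakens it. -/
theorem IsDP.of_le_smul {d : ℕ} {A : Type} [MeasurableSpace A] {M : DataSet d → Measure A}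
    {ε δ : ℝ} (hM : ∀ D, IsProbabilityMeasure (M D))
    (h : ∀ D D', Neighbouring D D' → M D ≤ ENNReal.ofReal (Real.exp ε) • M D') :
    IsDP M ε δ :=
  ⟨hM, fun D D' hD O _ => (h D D' hD O).trans (by simp)⟩

/-- Parallel composition. -/
theorem IsDP.pi_restrict {d : ℕ} {A : Type} [MeasurableSpace A] {m : ℕ}
    {M : Fin m → DataSet d → Measure A} {ε δ : ℝ} (hε : 0 ≤ ε) {C : Fin m → Set (Point d)}
    (hC : Pairwise (Function.onFun Disjoint C)) (hM : ∀ j D, IsProbabilityMeasure (M j D))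
    (h : ∀ j D D', Neighbouring D D' → M j D ≤ ENNReal.ofReal (Real.exp ε) • M j D') :
    IsDP (fun D => Measure.pi fun j => M j (DPMParams.restrict D (C j))) ε δ := by
  classical
  refine IsDP.of_le_smul (fun D => inferInstance) fun D D' hD => ?_
  obtain ⟨x, hx⟩ := hD.exists_filter
  set e := ENNReal.ofReal (Real.exp ε)
  have he : 1 ≤ e := by simpa [e] using hε
  have hle : ∀ j, M j (DPMParams.restrict D (C j)) ≤
      (if x ∈ C j then e else 1) • M j (DPMParams.restrict D' (C j)) := by
    intro j
    split_ifs with hj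
    · exact h j _ _ ((hx (· ∈ C j)).1 hj)
    · have : DPMParams.restrict D (C j) = DPMParams.restrict D' (C j) := (hx (· ∈ C j)).2 hj
      rw [this, one_smul]
  -- By disjointness at most one factor is `e`; if there is none, `1 ≤ e` is used.
  have hprod : ∏ j, (if x ∈ C j then e else 1) ≤ e := by
    by_cases hex : ∃ j, x ∈ C j
    · obtain ⟨j, hj⟩ := hex
      rw [Finset.prod_eq_single j (fun i _ hij => if_neg fun hi =>
        Set.disjoint_left.1 (hC hij) hi hj) (by simp), if_pos hj]
    · push Not at hex
      simpa [hex] using he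
  refine (pi_le_smul_pi (fun j => ?_) hle).trans ?_
  · split_ifs <;> simp [e]
  · exact Measure.le_iff.2 fun s _ => by
      simp only [Measure.smul_apply, smul_eq_mul]
      gcongr

/-! ### The Laplace mechanism -/

theorem isProbabilityMeasure_laplace {b : ℝ} (hb : 0 < b) : IsProbabilityMeasure (laplace b) := by
  have hneg : -b⁻¹ < 0 := by simpa using hb
  have hI : ∫ x : ℝ in Set.Ioi 0, Real.exp (-b⁻¹ * x) = b := by
    rw [integral_exp_mul_Ioi hneg]; simp
  have hint : IntegrableOn (fun x : ℝ => Real.exp (-b⁻¹ * x)) (Set.Ioi 0) :=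
    integrableOn_exp_mul_Ioi hneg 0
  have hf : (fun x : ℝ => 1 / (2 * b) * Real.exp (-|x| / b)) =
      fun x => (fun y => 1 / (2 * b) * Real.exp (-b⁻¹ * y)) |x| := by
    ext x; simp only; congr 2; field_simp
  have hone : ∫ x : ℝ, 1 / (2 * b) * Real.exp (-|x| / b) = 1 := by
    rw [hf, integral_comp_abs (f := fun y => 1 / (2 * b) * Real.exp (-b⁻¹ * y)),
      integral_const_mul, hI]
    field_simp
  -- A non-integrable function has Bochner integral `0`, so the value `1` already forces
  -- integrability.
  have hi : Integrable fun x : ℝ => 1 / (2 * b) * Real.exp (-|x| / b) := by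
    by_contra hn
    rw [integral_undef hn] at hone
    exact zero_ne_one hone
  refine ⟨?_⟩
  rw [laplace, withDensity_apply _ MeasurableSet.univ, setLIntegral_univ,
    ← ofReal_integral_eq_lintegral_ofReal hi (Filter.Eventually.of_forall fun x => by positivity),
    hone, ENNReal.ofReal_one]

/-- The shifted densities satisfy the bound pointwise, by the triangle inequality in the exponent.
-/
theorem map_add_laplace_le {b : ℝ} (hb : 0 < b) (u v : ℝ) :
    (laplace b).map (fun z => u + z) ≤
      ENNReal.ofReal (Real.exp (|u - v| / b)) • (laplace b).map (fun z => v + z) := by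
  have hmap : ∀ w : ℝ, ∀ s, MeasurableSet s → (laplace b).map (fun z => w + z) s =
      ∫⁻ y in s, ENNReal.ofReal (1 / (2 * b) * Real.exp (-|y - w| / b)) := by
    intro w s hs
    rw [Measure.map_apply (measurable_const_add w) hs, laplace,
      withDensity_apply _ (measurable_const_add w hs),
      ← (measurePreserving_add_left volume w).setLIntegral_comp_preimage hs (by fun_prop)]
    simp
  refine Measure.le_iff.2 fun s hs => ?_
  rw [Measure.smul_apply, hmap u s hs, hmap v s hs, smul_eq_mul,
    ← lintegral_const_mul _ (by fun_prop)]
  refine lintegral_mono fun y => ?_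
  rw [← ENNReal.ofReal_mul (Real.exp_pos _).le]
  refine ENNReal.ofReal_le_ofReal ?_
  rw [mul_left_comm, ← Real.exp_add, ← add_div]
  have h : |y - v| ≤ |y - u| + |u - v| := abs_sub_le _ _ _
  gcongr
  linarith

/-! ### The exponential mechanism -/

theorem isProbabilityMeasure_expMechanism {W : Type} [Fintype W] [Nonempty W] [MeasurableSpace W]
    (f : W → ℝ) (ε Δ : ℝ) : IsProbabilityMeasure (expMechanism f ε Δ) := by
  have hpos : 0 < ∑ s : W, Real.exp (ε * f s / (2 * Δ)) :=
    Finset.sum_pos (fun s _ => Real.exp_pos _) Finset.univ_nonempty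
  refine ⟨?_⟩
  rw [expMechanism, Measure.finsetSum_apply]
  simp only [Measure.smul_apply, measure_univ, smul_eq_mul, mul_one]
  rw [← ENNReal.ofReal_sum_of_nonneg fun s _ => by positivity, ← Finset.sum_div,
    div_self hpos.ne', ENNReal.ofReal_one]

/-- The weight and the normalising sum each contribute a factor `exp (ε / 2)`. -/
theorem expMechanism_le_smul {W : Type} [Fintype W] [Nonempty W] [MeasurableSpace W]
    {f f' : W → ℝ} {ε Δ : ℝ} (hε : 0 ≤ ε) (hΔ : 0 < Δ) (h : ∀ s, |f s - f' s| ≤ Δ) :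
    expMechanism f ε Δ ≤ ENNReal.ofReal (Real.exp ε) • expMechanism f' ε Δ := by
  have key : ∀ {g g' : W → ℝ}, (∀ s, |g s - g' s| ≤ Δ) → ∀ s,
      Real.exp (ε * g s / (2 * Δ)) ≤ Real.exp (ε / 2) * Real.exp (ε * g' s / (2 * Δ)) := by
    intro g g' hg s
    rw [← Real.exp_add]
    refine Real.exp_le_exp.2 ?_
    have h1 : g s ≤ Δ + g' s := by linarith [le_of_abs_le (hg s)]
    calc ε * g s / (2 * Δ) ≤ ε * (Δ + g' s) / (2 * Δ) := by gcongr
      _ = ε / 2 + ε * g' s / (2 * Δ) := by field_simp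
  have hpos : ∀ g : W → ℝ, 0 < ∑ s : W, Real.exp (ε * g s / (2 * Δ)) := fun g =>
    Finset.sum_pos (fun s _ => Real.exp_pos _) Finset.univ_nonempty
  have hsum : ∑ s : W, Real.exp (ε * f' s / (2 * Δ)) ≤
      Real.exp (ε / 2) * ∑ s : W, Real.exp (ε * f s / (2 * Δ)) := by
    rw [Finset.mul_sum]
    exact Finset.sum_le_sum fun s _ => key (fun s => by rw [abs_sub_comm]; exact h s) s
  refine Measure.le_iff.2 fun O _ => ?_
  rw [Measure.smul_apply, expMechanism, expMechanism, Measure.finsetSum_apply,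
    Measure.finsetSum_apply, smul_eq_mul, Finset.mul_sum]
  refine Finset.sum_le_sum fun s _ => ?_
  simp only [Measure.smul_apply, smul_eq_mul]
  rw [← mul_assoc, ← ENNReal.ofReal_mul (Real.exp_pos _).le]
  gcongr
  rw [← mul_div_assoc, div_le_div_iff₀ (hpos f) (hpos f')]
  calc Real.exp (ε * f s / (2 * Δ)) * ∑ s' : W, Real.exp (ε * f' s' / (2 * Δ))
      ≤ (Real.exp (ε / 2) * Real.exp (ε * f' s / (2 * Δ))) *
        (Real.exp (ε / 2) * ∑ s' : W, Real.exp (ε * f s' / (2 * Δ))) := by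
        gcongr
        exact key h s
    _ = Real.exp ε * Real.exp (ε * f' s / (2 * Δ)) *
        ∑ s' : W, Real.exp (ε * f s' / (2 * Δ)) := by
        have : Real.exp ε = Real.exp (ε / 2) * Real.exp (ε / 2) := by
          rw [← Real.exp_add]; congr 1; ring
        rw [this]; ring

namespace DPMParams

variable {d : ℕ} {P : DPMParams d} {εcnt εexp δ : ℝ}

/-! ### Sensitivity of the scoring function -/

section Sensitivity

variable {S S' : DataSet d} {n : ℝ}

/-- In the variable `h = n/2 - |r - n/2|` both formulas are affine with value `t` at the breakpoint
`h = n q`. This exhibits centreness as continuous and piecewise linear. -/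
theorem centreness_eq (hq : 0 < P.q) (hn : 0 < n) (S : DataSet d)
    (c : P.Candidate) :
    P.centreness S n c = P.t + ((n / 2 - |P.rank S c - n / 2|) - n * P.q) *
      if n * P.q < n / 2 - |P.rank S c - n / 2| then (1 - P.t) / (n / 2 - n * P.q)
      else P.t / (n * P.q) := by
  have hiff : (n * P.q < P.rank S c ∧ (P.rank S c : ℝ) < n - n * P.q) ↔
      n * P.q < n / 2 - |(P.rank S c : ℝ) - n / 2| := by
    rw [lt_sub_comm (c := |_|), abs_lt]
    constructor <;> rintro ⟨h1, h2⟩ <;> constructor <;> linarith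
  have hnq : 0 < n * P.q := mul_pos hn hq
  simp only [centreness, hiff]
  set h := n / 2 - |(P.rank S c : ℝ) - n / 2| with hh
  split_ifs with hlt
  -- The inner case rules out `2 q = 1`, where the denominators vanish.
  · have hlt' : n * P.q < n / 2 := hlt.trans_le (by simp [hh])
    have h1 : 0 < 1 - 2 * P.q := by
      have : n * (1 - 2 * P.q) > 0 := by linarith
      exact pos_of_mul_pos_right this hn.le
    have h2 : n / 2 - n * P.q = n * (1 - 2 * P.q) / 2 := by ring
    rw [h2]
    field_simp
    ring
  · field_simp
    ring

/-- A continuous piecewise linear function with slopes `L` and `K` in `[0, L]` is `L`-Lipschitz. -/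
theorem abs_mul_ite_sub_le {m K L : ℝ} (hK : 0 ≤ K) (hKL : K ≤ L) (x y : ℝ) :
    |(x - m) * (if m < x then K else L) - (y - m) * (if m < y then K else L)| ≤ L * |x - y| := by
  wlog hxy : y ≤ x generalizing x y
  · rw [abs_sub_comm, abs_sub_comm x]
    exact this y x (le_of_not_ge hxy)
  have hL := hK.trans hKL
  have h0 : 0 ≤ x - y := sub_nonneg.2 hxy
  rw [abs_of_nonneg h0, abs_le]
  split_ifs with hx hy hy
  · constructor <;> nlinarith
  · push Not at hy
    constructor <;> nlinarith
  · exact absurd (hy.trans_le hxy) hx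
  · constructor <;> nlinarith

theorem abs_centreness_sub_le (hq : 0 < P.q) (hqt : 2 * P.q ≤ P.t) (ht : P.t ≤ 1) (hn : 0 < n)
    (h : Neighbouring S S') (c : P.Candidate) :
    |P.centreness S n c - P.centreness S' n c| ≤ P.t / (n * P.q) := by
  have hnq : 0 < n * P.q := mul_pos hn hq
  have hden : 0 ≤ n / 2 - n * P.q := by nlinarith
  have hK : 0 ≤ (1 - P.t) / (n / 2 - n * P.q) := div_nonneg (by linarith) hden
  have hL : 0 ≤ P.t / (n * P.q) := div_nonneg (by linarith) hnq.le
  have hKL : (1 - P.t) / (n / 2 - n * P.q) ≤ P.t / (n * P.q) := by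
    -- If `2 q = 1`, the inner slope is `0` by division by zero. Otherwise the comparison of slopes
    -- amounts to `2 q ≤ t`.
    rcases hden.eq_or_lt with h0 | h0
    · rwa [← h0, div_zero]
    · rw [div_le_div_iff₀ h0 hnq]
      nlinarith
  rw [centreness_eq hq hn, centreness_eq hq hn, add_sub_add_left_eq_sub]
  refine (abs_mul_ite_sub_le hK hKL _ _).trans (mul_le_of_le_one_right hL ?_)
  rw [sub_sub_sub_cancel_left]
  refine (abs_abs_sub_abs_le_abs_sub _ _).trans ?_
  rw [sub_sub_sub_cancel_right, abs_sub_comm]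
  exact h.abs_card_filter_sub_card_filter _

theorem abs_emptiness_sub_le (hn : 0 < n) (h : Neighbouring S S') (c : P.Candidate) :
    |P.emptiness S n c - P.emptiness S' n c| ≤ 1 / n := by
  rw [emptiness, emptiness, sub_sub_sub_cancel_left, ← sub_div, abs_div, abs_of_pos hn,
    abs_sub_comm]
  gcongr
  exact h.abs_card_filter_sub_card_filter _

theorem abs_score_sub_le (hq : 0 < P.q) (hqt : 2 * P.q ≤ P.t) (ht : P.t ≤ 1) (hα : 0 ≤ P.α)
    (hn : 0 < n) (h : Neighbouring S S') (c : P.Candidate) :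
    |P.score S n c - P.score S' n c| ≤ (P.t / P.q + P.α) / n := by
  have h1 := abs_centreness_sub_le hq hqt ht hn h c
  have h2 := abs_emptiness_sub_le hn h c
  calc |P.score S n c - P.score S' n c|
      = |(P.centreness S n c - P.centreness S' n c) +
          P.α * (P.emptiness S n c - P.emptiness S' n c)| := by
        congr 1; simp only [score]; ring
    _ ≤ P.t / (n * P.q) + P.α * (1 / n) := by
        refine (abs_add_le _ _).trans (add_le_add h1 ?_)
        rw [abs_mul, abs_of_nonneg hα]
        gcongr
    _ = (P.t / P.q + P.α) / n := by field_simp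

end Sensitivity

/-- Neighbouring data sets are neighbouring on one side of a split and agree on the other. -/
theorem neighbouring_parts {S S' : DataSet d} (h : Neighbouring S S') (c : P.Candidate) :
    (Neighbouring (P.leftPart S c) (P.leftPart S' c) ∧ P.rightPart S c = P.rightPart S' c) ∨
    (P.leftPart S c = P.leftPart S' c ∧ Neighbouring (P.rightPart S c) (P.rightPart S' c)) := by
  obtain ⟨x, hx⟩ := h.exists_filter
  by_cases hxc : x c.1 ≤ P.position c
  · exact Or.inl ⟨(hx fun x => x c.1 ≤ P.position c).1 hxc,
      (hx fun x => P.position c < x c.1).2 hxc.not_gt⟩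
  · exact Or.inr ⟨(hx fun x => x c.1 ≤ P.position c).2 hxc,
      (hx fun x => P.position c < x c.1).1 (not_le.1 hxc)⟩

/-! ### Measurability -/

theorem measurable_score (S : DataSet d) (c : P.Candidate) :
    Measurable fun n => P.score S n c := by
  unfold score emptiness centreness
  refine Measurable.add (Measurable.ite (MeasurableSet.inter ?_ ?_)
    (by fun_prop) (by fun_prop)) (by fun_prop)
  · exact measurableSet_lt (f := fun n => n * P.q) (by fun_prop) measurable_const
  · exact measurableSet_lt (g := fun n => n - n * P.q) measurable_const (by fun_prop)

theorem measurable_selectSplit (γ : ℕ) (S : DataSet d) : Measurable (P.selectSplit γ S) := by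
  refine Measurable.ite (measurableSet_lt measurable_const measurable_id) ?_ measurable_const
  refine Measure.measurable_of_measurable_coe _ fun s _ => ?_
  have := measurable_score (P := P) S
  simp only [expMechanism, Measure.finsetSum_apply, Measure.smul_apply, smul_eq_mul]
  fun_prop

theorem measurable_splitAndCount_kernel (γ : ℕ) (S : DataSet d) :
    Measurable fun c => ((P.noisyCount (γ + 1) (P.leftPart S c)).prod
      (P.noisyCount (γ + 1) (P.rightPart S c))).map fun m => (c, m) :=
  measurable_of_finite _

theorem measurable_splitAndCount (γ : ℕ) (S : DataSet d) : Measurable (P.splitAndCount γ S) :=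
  (Measure.measurable_bind' (measurable_splitAndCount_kernel γ S)).comp
    (measurable_selectSplit γ S)

theorem measurable_map_selectSplit (γ : ℕ) (S : DataSet d) :
    Measurable fun n => (P.selectSplit γ S n).map fun c => (n, c) := by
  refine Measure.measurable_of_measurable_coe _ fun s hs => ?_
  have h : ∀ n, (P.selectSplit γ S n).map (fun c => (n, c)) s =
      ∑ c, P.selectSplit γ S n {c} * s.indicator 1 (n, c) := by
    intro n
    rw [Measure.map_apply measurable_prodMk_left hs,
      ← lintegral_indicator_one (measurable_prodMk_left hs), lintegral_fintype]
    exact Finset.sum_congr rfl fun c _ => mul_comm _ _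
  simp only [h]
  refine Finset.measurable_fun_sum _ fun c _ => Measurable.mul ?_ ?_
  · exact (Measure.measurable_coe (measurableSet_singleton c)).comp (measurable_selectSplit γ S)
  · exact (measurable_one.indicator hs).comp measurable_prodMk_right

theorem Clustering.measurable_leaf : ∀ k, Measurable (Clustering.leaf P k)
  | 0 => measurable_id
  | _ + 1 => measurable_inl

theorem Clustering.measurable_node {k : ℕ} (c : P.Candidate) :
    Measurable (Clustering.node P (k := k) c) :=
  measurable_inr.comp measurable_prodMk_left

/-- Output law of the recursive procedure once the split and the counts are known. -/
noncomputable def continueClustering (k γ : ℕ) (S : DataSet d) (n : ℝ) (o : P.Candidate × ℝ × ℝ) :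
    Measure (P.Clustering (k + 1)) :=
  if o.2.1 < P.τe ∨ o.2.2 < P.τe then
    Measure.dirac (Clustering.leaf P (k + 1) n)
  else
    ((P.buildClustering k (γ + 1) (P.leftPart S o.1) o.2.1).prod
      (P.buildClustering k (γ + 1) (P.rightPart S o.1) o.2.2)).map
        (Clustering.node P o.1)

theorem buildClustering_succ (k γ : ℕ) (S : DataSet d) (n : ℝ) :
    P.buildClustering (k + 1) γ S n =
      (P.splitAndCount γ S n).bind (P.continueClustering k γ S n) := rfl

namespace Valid

theorem nonempty_candidate (hP : P.Valid εcnt εexp δ) : Nonempty P.Candidate := by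
  have h : 0 < P.numSplits := Nat.ceil_pos.2 (div_pos (sub_pos.2 hP.range) hP.β_pos)
  exact ⟨⟨0, hP.dim_pos⟩, ⟨0, h⟩⟩

theorem εcnt_nonneg (hP : P.Valid εcnt εexp δ) : 0 ≤ εcnt :=
  (hP.εcnt_pos 0 (Nat.zero_le _)).le.trans (hP.εcnt_le 0 (Nat.zero_le _))

theorem εexp_nonneg (hP : P.Valid εcnt εexp δ) : 0 ≤ εexp :=
  (hP.εexp_pos 0 hP.τr_pos).le.trans (hP.εexp_le 0 hP.τr_pos)

variable {γ : ℕ} {S S' : DataSet d}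

/-! ### The output laws are probability measures -/

theorem isProbabilityMeasure_noisyCount (hP : P.Valid εcnt εexp δ) (hγ : γ ≤ P.τr)
    (S : DataSet d) : IsProbabilityMeasure (P.noisyCount γ S) := by
  have := isProbabilityMeasure_laplace (one_div_pos.2 (hP.εcnt_pos γ hγ))
  exact Measure.isProbabilityMeasure_map (measurable_const_add _).aemeasurable

theorem isProbabilityMeasure_selectSplit (hP : P.Valid εcnt εexp δ) (γ : ℕ) (S : DataSet d)
    (n : ℝ) : IsProbabilityMeasure (P.selectSplit γ S n) := by
  have := hP.nonempty_candidate
  unfold selectSplit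
  split_ifs
  · exact isProbabilityMeasure_expMechanism _ _ _
  · exact isProbabilityMeasure_uniformOn Set.finite_univ Set.univ_nonempty

theorem isProbabilityMeasure_splitAndCount (hP : P.Valid εcnt εexp δ) (hγ : γ < P.τr)
    (S : DataSet d) (n : ℝ) : IsProbabilityMeasure (P.splitAndCount γ S n) := by
  have := hP.isProbabilityMeasure_selectSplit γ S n
  have := hP.isProbabilityMeasure_noisyCount (γ := γ + 1) hγ
  exact isProbabilityMeasure_bind_of_measurable (measurable_splitAndCount_kernel γ S) fun c =>
    Measure.isProbabilityMeasure_map measurable_prodMk_left.aemeasurable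

theorem isProbabilityMeasure_countAndSplit (hP : P.Valid εcnt εexp δ) (hγ : γ ≤ P.τr)
    (S : DataSet d) : IsProbabilityMeasure (P.countAndSplit γ S) := by
  have := hP.isProbabilityMeasure_selectSplit γ S
  have := hP.isProbabilityMeasure_noisyCount hγ S
  exact isProbabilityMeasure_bind_of_measurable (measurable_map_selectSplit γ S) fun n =>
    Measure.isProbabilityMeasure_map measurable_prodMk_left.aemeasurable

/-- Joint measurability is needed because `n` determines both the law of the split and the weight of
a leaf. -/
theorem measurable_continueClustering {k : ℕ}
    (hm : ∀ S, Measurable (P.buildClustering k (γ + 1) S))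
    (hp : ∀ S n, IsProbabilityMeasure (P.buildClustering k (γ + 1) S n)) (S : DataSet d) :
    Measurable fun p : ℝ × P.Candidate × ℝ × ℝ => P.continueClustering k γ S p.1 p.2 := by
  have h : Measurable fun p : P.Candidate × ℝ × ℝ × ℝ =>
      P.continueClustering k γ S p.2.1 (p.1, p.2.2) := by
    -- There are finitely many candidates; for a fixed one the two parts are fixed data sets.
    refine measurable_from_prod_countable_right fun c => Measurable.ite ?_ ?_ ?_
    · exact (measurableSet_lt (f := fun p : ℝ × ℝ × ℝ => p.2.1) (by fun_prop)
        measurable_const).union (measurableSet_lt (f := fun p : ℝ × ℝ × ℝ => p.2.2) (by fun_prop)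
        measurable_const)
    · exact Measure.measurable_dirac.comp ((Clustering.measurable_leaf _).comp measurable_fst)
    · refine (Measure.measurable_map _ (Clustering.measurable_node c)).comp ?_
      exact Measurable.measure_prod_of_isProbabilityMeasure
        ((hm (P.leftPart S c)).comp (measurable_fst.comp measurable_snd))
        ((hm (P.rightPart S c)).comp (measurable_snd.comp measurable_snd))
  exact h.comp (f := fun p : ℝ × P.Candidate × ℝ × ℝ => (p.2.1, p.1, p.2.2)) (by fun_prop)

theorem isProbabilityMeasure_continueClustering {k : ℕ}
    (hp : ∀ S n, IsProbabilityMeasure (P.buildClustering k (γ + 1) S n)) (S : DataSet d) (n : ℝ)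
    (o : P.Candidate × ℝ × ℝ) : IsProbabilityMeasure (P.continueClustering k γ S n o) := by
  unfold continueClustering
  split_ifs
  · infer_instance
  · exact Measure.isProbabilityMeasure_map (Clustering.measurable_node _).aemeasurable

/-- Both properties go through one induction: measurability of the product law uses that the subtree
laws are probability measures. The bound `γ + k ≤ τr` keeps all budgets positive. -/
theorem measurable_and_isProbabilityMeasure_buildClustering (hP : P.Valid εcnt εexp δ) (k γ : ℕ)
    (hγ : γ + k ≤ P.τr) (S : DataSet d) : Measurable (P.buildClustering k γ S) ∧
      ∀ n, IsProbabilityMeasure (P.buildClustering k γ S n) := by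
  induction k generalizing γ S with
  | zero =>
    exact ⟨Measure.measurable_dirac.comp (Clustering.measurable_leaf 0),
      fun n => Measure.dirac.isProbabilityMeasure⟩
  | succ k ih =>
    have hγ' : γ + 1 + k ≤ P.τr := by omega
    have hp := hP.isProbabilityMeasure_splitAndCount (γ := γ) (by omega) S
    have hm := measurable_continueClustering (fun S => (ih (γ + 1) hγ' S).1)
      (fun S => (ih (γ + 1) hγ' S).2) S
    have hm' : ∀ n, Measurable (P.continueClustering k γ S n) := fun n =>
      hm.comp (measurable_prodMk_left (x := n))
    have hp' := isProbabilityMeasure_continueClustering (fun S => (ih (γ + 1) hγ' S).2) S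
    refine ⟨?_, fun n => ?_⟩
    · rw [funext (buildClustering_succ k γ S)]
      exact Measurable.bind_of_measurable_prod
        (η := fun p => P.continueClustering k γ S p.1 p.2) (measurable_splitAndCount γ S) hm
    · rw [buildClustering_succ]
      exact isProbabilityMeasure_bind_of_measurable (hm' n) (hp' n)

/-! ### Privacy -/

theorem noisyCount_le_smul (hP : P.Valid εcnt εexp δ) (hγ : γ ≤ P.τr)
    (h : Neighbouring S S') :
    P.noisyCount γ S ≤ ENNReal.ofReal (Real.exp εcnt) • P.noisyCount γ S' := by
  refine (map_add_laplace_le (one_div_pos.2 (hP.εcnt_pos γ hγ)) _ (S'.card : ℝ)).trans ?_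
  rw [h.abs_card_sub_card, one_div_one_div]
  refine smul_mono_of_le ?_ _
  gcongr
  exact hP.εcnt_le γ hγ

/-- Since `λ_γ ≥ 0`, subtracting it from `n` only enlarges the sensitivity parameter, so no relation
between `n` and the true count is needed. -/
theorem selectSplit_le_smul (hP : P.Valid εcnt εexp δ) (hγ : γ < P.τr)
    (h : Neighbouring S S') (n : ℝ) :
    P.selectSplit γ S n ≤ ENNReal.ofReal (Real.exp εexp) • P.selectSplit γ S' n := by
  have := hP.nonempty_candidate
  unfold selectSplit
  split_ifs with hn
  · have hlam := hP.lam_nonneg γ hγ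
    have hn0 : 0 < n := hlam.trans_lt hn
    have hq : 0 < P.q := by linarith [hP.q_pos]
    have ht : 0 < P.t := hP.q_pos.trans_le hP.q_le_t
    have hα := hP.α_pos
    have hnum : 0 < P.t / P.q + P.α := by positivity
    refine (expMechanism_le_smul (hP.εexp_pos γ hγ).le (div_pos hnum (sub_pos.2 hn))
      fun c => (abs_score_sub_le hq hP.q_le_t hP.t_le_one hα.le hn0 h c).trans ?_).trans ?_
    · exact div_le_div_of_nonneg_left hnum.le (sub_pos.2 hn) (by linarith)
    · gcongr
      exact hP.εexp_le γ hγ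
  · exact le_smul_self_of_one_le (by simpa using hP.εexp_nonneg) _

/-- Running a private algorithm on one side of a split and another on the other side. -/
theorem prod_parts_le_smul {A : Type} [MeasurableSpace A] {M M' : DataSet d → Measure A}
    {e : ℝ≥0∞} [∀ S, SFinite (M' S)] (hM : ∀ S S', Neighbouring S S' → M S ≤ e • M S')
    (hM' : ∀ S S', Neighbouring S S' → M' S ≤ e • M' S') (h : Neighbouring S S')
    (c : P.Candidate) :
    (M (P.leftPart S c)).prod (M' (P.rightPart S c)) ≤
      e • (M (P.leftPart S' c)).prod (M' (P.rightPart S' c)) := by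
  rcases neighbouring_parts h c with ⟨h1, h2⟩ | ⟨h1, h2⟩
  · rw [h2]
    simpa using prod_le_smul_prod (hM _ _ h1)
      (one_smul ℝ≥0∞ (M' (P.rightPart S' c))).ge
  · rw [h1]
    simpa using prod_le_smul_prod (one_smul ℝ≥0∞ (M (P.leftPart S' c))).ge (hM' _ _ h2)

/-- For a fixed split one part is unchanged, so the two counts together cost a single `εcnt`. -/
theorem splitAndCount_le_smul (hP : P.Valid εcnt εexp δ) (hγ : γ < P.τr)
    (h : Neighbouring S S') (n : ℝ) :
    P.splitAndCount γ S n ≤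
      ENNReal.ofReal (Real.exp (εcnt + εexp)) • P.splitAndCount γ S' n := by
  have := hP.isProbabilityMeasure_noisyCount (γ := γ + 1) hγ
  rw [add_comm, Real.exp_add, ENNReal.ofReal_mul (Real.exp_pos _).le]
  refine bind_le_smul_bind (measurable_splitAndCount_kernel γ S)
    (measurable_splitAndCount_kernel γ S') (hP.selectSplit_le_smul hγ h n) fun c => ?_
  exact map_le_smul_map measurable_prodMk_left (prod_parts_le_smul
    (fun _ _ => hP.noisyCount_le_smul hγ) (fun _ _ => hP.noisyCount_le_smul hγ) h c)

theorem countAndSplit_le_smul (hP : P.Valid εcnt εexp δ) (hγ : γ < P.τr)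
    (h : Neighbouring S S') :
    P.countAndSplit γ S ≤ ENNReal.ofReal (Real.exp (εcnt + εexp)) • P.countAndSplit γ S' := by
  rw [Real.exp_add, ENNReal.ofReal_mul (Real.exp_pos _).le]
  exact bind_le_smul_bind (measurable_map_selectSplit γ S) (measurable_map_selectSplit γ S')
    (hP.noisyCount_le_smul hγ.le h) fun n =>
      map_le_smul_map measurable_prodMk_left (hP.selectSplit_le_smul hγ h n)

/-- Once the split and counts are fixed, both runs take the same branch, and their recursive calls
differ on one side only. The induction therefore pays for one subtree, not two. -/
theorem buildClustering_le_smul (hP : P.Valid εcnt εexp δ) (k γ : ℕ) (hγ : γ + k ≤ P.τr)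
    (h : Neighbouring S S') (n : ℝ) :
    P.buildClustering k γ S n ≤
      ENNReal.ofReal (Real.exp (k * (εcnt + εexp))) • P.buildClustering k γ S' n := by
  induction k generalizing γ S S' n with
  | zero => simp [buildClustering]
  | succ k ih =>
    have hγ' : γ + 1 + k ≤ P.τr := by omega
    have hb := fun S => hP.measurable_and_isProbabilityMeasure_buildClustering k (γ + 1) hγ' S
    have hm := fun S => measurable_continueClustering (fun S => (hb S).1) (fun S => (hb S).2) S
    have hexp : ((k + 1 : ℕ) : ℝ) * (εcnt + εexp) = (εcnt + εexp) + k * (εcnt + εexp) := by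
      push_cast; ring
    rw [hexp, Real.exp_add, ENNReal.ofReal_mul (Real.exp_pos _).le]
    refine bind_le_smul_bind ((hm S).comp measurable_prodMk_left)
      ((hm S').comp measurable_prodMk_left)
      (hP.splitAndCount_le_smul (by omega) h n) fun o => ?_
    show P.continueClustering k γ S n o ≤ _ • P.continueClustering k γ S' n o
    unfold continueClustering
    split_ifs
    -- On stopping, both runs output the same leaf of weight `n`, so any factor at least `1`
    -- suffices.
    · have := hP.εcnt_nonneg
      have := hP.εexp_nonneg
      exact le_smul_self_of_one_le (by simp; positivity) _
    · have := fun S => (hb S).2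
      exact map_le_smul_map (Clustering.measurable_node _) (prod_parts_le_smul
        (M := fun S => P.buildClustering k (γ + 1) S o.2.1)
        (M' := fun S => P.buildClustering k (γ + 1) S o.2.2)
        (fun _ _ h => ih _ hγ' h _) (fun _ _ h => ih _ hγ' h _) h o.1)

end Valid

end DPMParams

theorem mainTheorem2 {d : ℕ} (P : DPMParams d) (εcnt εexp δcnt : ℝ)
    (hP : P.Valid εcnt εexp δcnt) :
    -- one call of the recursive procedure: split selection and noisy counts of both parts,
    -- in parallel on disjoint subsets of one level
    (∀ γ < P.τr, ∀ (m : ℕ) (C : Fin m → Set (Point d)),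
      Pairwise (Function.onFun Disjoint C) → ∀ n : Fin m → ℝ,
      IsDP (fun D => MeasureTheory.Measure.pi fun j =>
        P.splitAndCount γ (DPMParams.restrict D (C j)) (n j)) (εcnt + εexp) δcnt) ∧
    -- noisy count and subsequent split selection, in parallel on disjoint subsets of one level
    (∀ γ < P.τr, ∀ (m : ℕ) (C : Fin m → Set (Point d)),
      Pairwise (Function.onFun Disjoint C) →
      IsDP (fun D => MeasureTheory.Measure.pi fun j =>
        P.countAndSplit γ (DPMParams.restrict D (C j))) (εcnt + εexp) δcnt) ∧
    -- all clusters and weights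
    IsDP P.clustersAndWeights ((P.τr + 1) * εcnt + P.τr * εexp) ((P.τr + 1) * δcnt) := by
  have hε : 0 ≤ εcnt + εexp := add_nonneg hP.εcnt_nonneg hP.εexp_nonneg
  refine ⟨fun γ hγ m C hC n => ?_, fun γ hγ m C hC => ?_, ?_⟩
  · exact IsDP.pi_restrict
      (M := fun j D => P.splitAndCount γ D (n j)) hε hC
      (fun j D => hP.isProbabilityMeasure_splitAndCount hγ D (n j))
      fun j D D' h => hP.splitAndCount_le_smul hγ h (n j)
  · exact IsDP.pi_restrict hε hC (fun _ D => hP.isProbabilityMeasure_countAndSplit hγ.le D)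
      fun _ D D' h => hP.countAndSplit_le_smul hγ h
  · have hb := fun D => hP.measurable_and_isProbabilityMeasure_buildClustering P.τr 0 (by simp) D
    have hexp : (P.τr + 1) * εcnt + P.τr * εexp = εcnt + P.τr * (εcnt + εexp) := by ring
    refine IsDP.of_le_smul (fun D => ?_) fun D D' h => ?_
    · have := hP.isProbabilityMeasure_noisyCount (Nat.zero_le _) D
      exact isProbabilityMeasure_bind_of_measurable (hb D).1 (hb D).2
    · rw [hexp, Real.exp_add, ENNReal.ofReal_mul (Real.exp_pos _).le]
      exact bind_le_smul_bind (hb D).1 (hb D').1 (hP.noisyCount_le_smul (Nat.zero_le _) h)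
        fun n => hP.buildClustering_le_smul _ _ (by simp) h n
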